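/- Let $N\ge 1$, let $\mathbb{R}^N$ carry the Euclidean norm, and let $A$ be a real $N\times N$ matrix such that $A^{*}A$ is positive definite ($A^{*}$ denotes the transpose of $A$), with largest eigenvalue $\lambda_N$. Let $F:\mathbb{R}^N\to\mathbb{R}^N$ be locally Lipschitz, i.e. every point of $\mathbb{R}^N$ has a neighbourhood on which $F$ is Lipschitz. For $x\in\mathbb{R}^N$ let $\partial F(x)$ denote Clarke's generalized Jacobian of $F$ at $x$, i.e. the convex hull of the set of all matrices of the form $\lim_{i\to\infty}F'(x_i)$, where $x_i\to x$, $F$ is differentiable at each $x_i$ with Jacobian matrix $F'(x_i)$, and the limit exists. Assume that (i) there exists a constant $b>\sqrt{\lambda_N}$ such that $\|F(x)\|\ge b\|x\|$ for all $x\in\mathbb{R}^N$ with $\|x\|$ sufficiently large; (ii) $\det(A-B)\ne 0$ for every $x\in\mathbb{R}^N$ and every $B\in\partial F(x)$. Then for every $\xi\in\mathbb{R}^N$ the equation $Ax=F(x)+\xi$ has exactly one solution $x\in\mathbb{R}^N$. -/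

import Mathlib

open Filter Topology

/-- The Jacobian matrix of `f : ℝⁿ → ℝᵏ` at `x`, i.e. the matrix of the Fréchet derivative in the
standard bases. It is meaningful at points of differentiability. -/
noncomputable def jacobianMatrix {n k : ℕ}
    (f : EuclideanSpace ℝ (Fin n) → EuclideanSpace ℝ (Fin k)) (x : EuclideanSpace ℝ (Fin n)) :
    Matrix (Fin k) (Fin n) ℝ :=
  Matrix.of fun i j => fderiv ℝ f x (EuclideanSpace.single j 1) i

/-- The limits of Jacobian matrices of `f` along sequences of points of differentiability
converging to `x` (sometimes called the B-subdifferential). -/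
def limitingJacobians {n k : ℕ}
    (f : EuclideanSpace ℝ (Fin n) → EuclideanSpace ℝ (Fin k)) (x : EuclideanSpace ℝ (Fin n)) :
    Set (Matrix (Fin k) (Fin n) ℝ) :=
  {B | ∃ u : ℕ → EuclideanSpace ℝ (Fin n),
    (∀ i, DifferentiableAt ℝ f (u i)) ∧ Tendsto u atTop (𝓝 x) ∧
      Tendsto (fun i => jacobianMatrix f (u i)) atTop (𝓝 B)}

/-- Clarke's generalized Jacobian `∂f(x)` of a locally Lipschitz map `f : ℝⁿ → ℝᵏ`: the convex hull
of all limits of Jacobian matrices of `f` at points of differentiability converging to `x`. -/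
def generalizedJacobian {n k : ℕ}
    (f : EuclideanSpace ℝ (Fin n) → EuclideanSpace ℝ (Fin k)) (x : EuclideanSpace ℝ (Fin n)) :
    Set (Matrix (Fin k) (Fin n) ℝ) :=
  convexHull ℝ (limitingJacobians f x)

theorem IsCompact.convexHull_of_finiteDimensional {E : Type*} [NormedAddCommGroup E]
    [NormedSpace ℝ E] [FiniteDimensional ℝ E] {K : Set E} (hK : IsCompact K) :
    IsCompact (convexHull ℝ K) := by
  have key : convexHull ℝ K = ⋃ n ∈ Set.Iic (Module.finrank ℝ E + 1),
      (fun p : (Fin n → ℝ) × (Fin n → E) => ∑ i, p.1 i • p.2 i) ''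
        (stdSimplex ℝ (Fin n) ×ˢ Set.pi Set.univ fun _ => K) := by
    apply Set.Subset.antisymm
    · intro x hx
      obtain ⟨ι, _, z, w, hz, hind, hw, hw1, rfl⟩ := eq_pos_convex_span_of_mem_convexHull hx
      let e := (Fintype.equivFin ι).symm
      refine Set.mem_biUnion (x := Fintype.card ι) ?_ ⟨(w ∘ e, z ∘ e), ⟨⟨?_, ?_⟩, ?_⟩, ?_⟩
      · refine hind.card_le_finrank_succ.trans ?_
        gcongr
        exact Submodule.finrank_le _
      · exact fun i => (hw _).le
      · simpa using (Equiv.sum_comp e w).trans hw1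
      · exact fun i _ => hz (Set.mem_range_self _)
      · exact Equiv.sum_comp e fun i => w i • z i
    · refine Set.iUnion₂_subset fun n _ => ?_
      rintro _ ⟨⟨w, z⟩, ⟨⟨hw, hw1⟩, hz⟩, rfl⟩
      exact (convex_convexHull ℝ K).sum_mem (fun i _ => hw i) hw1
        fun i _ => subset_convexHull ℝ K (hz i trivial)
  rw [key]
  refine (Set.finite_Iic _).isCompact_biUnion fun n _ => ?_
  refine ((isCompact_stdSimplex ℝ (Fin n)).prod (isCompact_univ_pi fun _ => hK)).image ?_
  fun_prop

section LocalHomeomorph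

variable {X Y : Type*} [TopologicalSpace X] [TopologicalSpace Y]

theorem IsOpenMap.isLocalHomeomorph_of_locally_injOn {f : X → Y} (hf : Continuous f)
    (ho : IsOpenMap f) (hi : ∀ x, ∃ U ∈ 𝓝 x, Set.InjOn f U) : IsLocalHomeomorph f := by
  rw [isLocalHomeomorph_iff_isOpenEmbedding_restrict]
  intro x
  obtain ⟨U, hU, hinj⟩ := hi x
  refine ⟨interior U, interior_mem_nhds.2 hU, ?_⟩
  refine .of_continuous_injective_isOpenMap (hf.comp continuous_subtype_val) ?_ ?_
  · exact (hinj.mono interior_subset).injective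
  · exact ho.domRestrict isOpen_interior

theorem IsCoveringMap.injective_of_simplyConnectedSpace {f : X → Y} (hf : IsCoveringMap f)
    [PathConnectedSpace X] [SimplyConnectedSpace Y] : Function.Injective f := by
  intro a b hab
  obtain ⟨γ⟩ := PathConnectedSpace.joined a b
  have h := hf.liftPath_apply_one_eq_of_homotopicRel
    (γ₀ := (γ.map hf.continuous : Path (f a) (f b)).cast rfl hab) (γ₁ := Path.refl (f a))
    (SimplyConnectedSpace.paths_homotopic _ _) a (by simp) (by simp)
  have h1 : (γ : C(unitInterval, X)) = hf.liftPath
      ((γ.map hf.continuous : Path (f a) (f b)).cast rfl hab) a (by simp) :=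
    (hf.eq_liftPath_iff' _).2 ⟨by ext; simp, γ.source⟩
  have h2 : ContinuousMap.const unitInterval a = hf.liftPath (Path.refl (f a)) a (by simp) :=
    (hf.eq_liftPath_iff' _).2 ⟨by ext; simp, rfl⟩
  rw [← h1, ← h2] at h
  simpa using h.symm

theorem IsLocalHomeomorph.bijective_of_isProperMap [T2Space X] [T1Space Y] [PathConnectedSpace X]
    [SimplyConnectedSpace Y] {f : X → Y} (hf : IsLocalHomeomorph f) (hp : IsProperMap f) :
    Function.Bijective f := by
  have hfin : ∀ y, (f ⁻¹' {y}).Finite := fun y => by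
    refine (hp.isCompact_preimage isCompact_singleton).finite ?_
    refine (hf.isLocalHomeomorphOn.mono (Set.subset_univ (f ⁻¹' {y}))).isDiscrete_of_image ?_
    exact (Set.subsingleton_singleton.anti (Set.image_preimage_subset f {y})).isDiscrete
  have hcov : IsCoveringMap f := isCoveringMap_iff_isCoveringMapOn_univ.2 <|
    hp.isClosedMap.isCoveringMapOn_of_isLocalHomeomorphOn (fun y _ => hfin y)
      (hf.isLocalHomeomorphOn.mono (Set.subset_univ _))
  refine ⟨hcov.injective_of_simplyConnectedSpace, Set.range_eq_univ.1 ?_⟩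
  exact IsClopen.eq_univ ⟨hp.isClosedMap.isClosed_range, hf.isOpenMap.isOpen_range⟩
    (Set.range_nonempty f)

end LocalHomeomorph

/-- A lower bound for a directional derivative of a Lipschitz map at its points of
differentiability integrates to a lower bound for the increments in that direction. -/
theorem LipschitzOnWith.mul_le_of_forall_le_fderiv {E F : Type*}
    [NormedAddCommGroup E] [NormedSpace ℝ E] [FiniteDimensional ℝ E]
    [NormedAddCommGroup F] [NormedSpace ℝ F] [FiniteDimensional ℝ F]
    {G : E → F} {C : NNReal} {s : Set E} (hG : LipschitzOnWith C G s) (hs : IsOpen s)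
    (hconv : Convex ℝ s) (f : F →L[ℝ] ℝ) (v : E) {δ : ℝ}
    (hδ : ∀ z ∈ s, DifferentiableAt ℝ G z → δ ≤ f (fderiv ℝ G z v))
    {y : E} {h : ℝ} (hh : 0 ≤ h) (hy : y ∈ s) (hy' : y + h • v ∈ s) :
    δ * h ≤ f (G (y + h • v) - G y) := by
  let _ : MeasurableSpace E := borel E
  have : BorelSpace E := ⟨rfl⟩
  let μ : MeasureTheory.Measure E := MeasureTheory.Measure.addHaar
  have hdiff : ∀ᵐ z ∂μ, z ∈ s → DifferentiableAt ℝ G z := by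
    filter_upwards [hG.ae_differentiableWithinAt_of_mem (μ := μ)] with z hz hzs
    exact (hz hzs).differentiableAt (hs.mem_nhds hzs)
  have hlines : ∀ᵐ z ∂μ, ∀ᵐ t : ℝ, z + t • v ∈ s → DifferentiableAt ℝ G (z + t • v) := by
    obtain ⟨T, hTsub, hTmeas, hTnull⟩ := MeasureTheory.exists_measurable_superset_of_null
      (MeasureTheory.ae_iff.1 hdiff)
    have hmeas : MeasurableSet {p : ℝ × E | p.2 + p.1 • v ∉ T} :=
      (by fun_prop : Measurable fun p : ℝ × E => p.2 + p.1 • v) hTmeas.compl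
    have h1 : ∀ᵐ t : ℝ, ∀ᵐ z ∂μ, z + t • v ∉ T := by
      refine .of_forall fun t => ?_
      rw [MeasureTheory.ae_iff]
      simpa [Set.preimage] using
        (MeasureTheory.measure_preimage_add_right μ (t • v) T).trans hTnull
    have h2 := (MeasureTheory.Measure.ae_ae_comm hmeas).1 h1
    filter_upwards [h2] with z hz
    filter_upwards [hz] with t ht
    by_contra hcon
    exact ht (hTsub hcon)
  have hgood : ∀ z, z ∈ s → z + h • v ∈ s →
      (∀ᵐ t : ℝ, z + t • v ∈ s → DifferentiableAt ℝ G (z + t • v)) →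
      δ * h ≤ f (G (z + h • v) - G z) := by
    intro z hz hz' hae
    have hseg : ∀ t ∈ Set.Icc 0 h, z + t • v ∈ s := by
      intro t ht
      rcases hh.eq_or_lt with rfl | hpos
      · simpa [show t = 0 by linarith [ht.1, ht.2]] using hz
      have := hconv.add_smul_sub_mem hz hz' (t := t / h)
        ⟨div_nonneg ht.1 hh, div_le_one_of_le₀ ht.2 hh⟩
      simpa [smul_smul, div_mul_cancel₀ _ hpos.ne'] using this
    set φ : ℝ → ℝ := fun t => f (G (z + t • v)) with hφ
    have hlip : LipschitzOnWith (‖f‖₊ * (C * ‖v‖₊)) φ (Set.uIcc 0 h) := by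
      rw [Set.uIcc_of_le hh]
      refine f.lipschitz.comp_lipschitzOnWith (hG.comp (f := fun t : ℝ => z + t • v) ?_ hseg)
      refine LipschitzWith.lipschitzOnWith (LipschitzWith.of_dist_le_mul fun a b => ?_)
      rw [dist_add_left, dist_eq_norm, ← sub_smul, norm_smul, dist_eq_norm, mul_comm, coe_nnnorm]
    have hac := hlip.absolutelyContinuousOnInterval
    have hint := hac.integral_deriv_eq_sub
    have hle : ∫ _ in (0 : ℝ)..h, δ ≤ ∫ t in (0 : ℝ)..h, deriv φ t := by
      refine intervalIntegral.integral_mono_ae_restrict hh (by simp)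
        hac.intervalIntegrable_deriv ?_
      rw [Filter.EventuallyLE, MeasureTheory.ae_restrict_iff' measurableSet_Icc]
      filter_upwards [hae] with t ht hmem
      have hd := ht (hseg t hmem)
      have h1 : HasDerivAt (fun t : ℝ => z + t • v) v t := by
        simpa using ((hasDerivAt_id t).smul_const v).const_add z
      have h2 : HasDerivAt φ (f (fderiv ℝ G (z + t • v) v)) t :=
        f.hasFDerivAt.comp_hasDerivAt t (hd.hasFDerivAt.comp_hasDerivAt t h1)
      rw [h2.deriv]
      exact hδ _ (hseg t hmem) hd
    rw [hint] at hle
    simpa [hφ, mul_comm] using hle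
  have hdense := MeasureTheory.Measure.dense_of_ae hlines
  have hcy : ContinuousAt G y := hG.continuousOn.continuousAt (hs.mem_nhds hy)
  have hcy' : ContinuousAt (fun z => G (z + h • v)) y :=
    ContinuousAt.comp (f := fun z => z + h • v)
      (hG.continuousOn.continuousAt (hs.mem_nhds hy')) (by fun_prop)
  have hcont : ContinuousAt (fun z => f (G (z + h • v) - G z)) y :=
    f.continuous.continuousAt.comp (hcy'.sub hcy)
  refine ge_of_tendsto_of_frequently hcont ?_
  have h1 : ∀ᶠ z in 𝓝 y, z ∈ s := hs.mem_nhds hy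
  have h2 : ∀ᶠ z in 𝓝 y, z + h • v ∈ s :=
    (show ContinuousAt (fun z => z + h • v) y by fun_prop).eventually (hs.mem_nhds hy')
  have h3 := mem_closure_iff_frequently.1 (hdense y)
  exact (h3.and_eventually (h1.and h2)).mono fun z hz => hgood z hz.2.1 hz.2.2 hz.1

section ClusterDerivatives

variable {E F : Type*} [NormedAddCommGroup E] [NormedSpace ℝ E]
  [NormedAddCommGroup F] [NormedSpace ℝ F]

/-- The cluster points at `x` of the Fréchet derivative of `G` along its points of
differentiability. -/
def clusterDerivatives (G : E → F) (x : E) : Set (E →L[ℝ] F) :=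
  {T | MapClusterPt T (𝓝[{z | DifferentiableAt ℝ G z}] x) (fderiv ℝ G)}

theorem isClosed_clusterDerivatives (G : E → F) (x : E) : IsClosed (clusterDerivatives G x) :=
  isClosed_setOfPred_clusterPt

theorem LocallyLipschitz.exists_eventually_norm_fderiv_le {G : E → F} (hG : LocallyLipschitz G)
    (x : E) : ∃ C : ℝ, ∀ᶠ z in 𝓝 x, ‖fderiv ℝ G z‖ ≤ C := by
  obtain ⟨C, t, ht, hL⟩ := hG x
  refine ⟨C, ?_⟩
  filter_upwards [eventually_mem_nhds_iff.2 ht] with z hz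
  exact norm_fderiv_le_of_lipschitzOn ℝ hz hL

variable [FiniteDimensional ℝ E] [FiniteDimensional ℝ F]

theorem LocallyLipschitz.isCompact_clusterDerivatives {G : E → F} (hG : LocallyLipschitz G)
    (x : E) : IsCompact (clusterDerivatives G x) := by
  have : ProperSpace (E →L[ℝ] F) := FiniteDimensional.proper ℝ _
  obtain ⟨C, hC⟩ := hG.exists_eventually_norm_fderiv_le x
  refine (isCompact_closedBall (0 : E →L[ℝ] F) C).of_isClosed_subset
    (isClosed_clusterDerivatives G x) fun T hT => ?_
  refine Metric.isClosed_closedBall.mem_of_mapClusterPt hT ?_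
  filter_upwards [nhdsWithin_le_nhds hC] with z hz
  simpa using hz

theorem LocallyLipschitz.eventually_fderiv_mem {G : E → F} (hG : LocallyLipschitz G) {x : E}
    {U : Set (E →L[ℝ] F)} (hU : IsOpen U) (hsub : clusterDerivatives G x ⊆ U) :
    ∀ᶠ z in 𝓝 x, DifferentiableAt ℝ G z → fderiv ℝ G z ∈ U := by
  have : ProperSpace (E →L[ℝ] F) := FiniteDimensional.proper ℝ _
  obtain ⟨C, hC⟩ := hG.exists_eventually_norm_fderiv_le x
  by_contra hcon
  have hfreq : ∃ᶠ z in 𝓝[{z | DifferentiableAt ℝ G z}] x, fderiv ℝ G z ∈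
      Metric.closedBall (0 : E →L[ℝ] F) C ∩ Uᶜ := by
    rw [frequently_nhdsWithin_iff]
    refine ((not_eventually.1 hcon).and_eventually hC).mono fun z hz => ?_
    obtain ⟨h1, h2⟩ := Classical.not_imp.1 hz.1
    exact ⟨⟨by simpa using hz.2, h2⟩, h1⟩
  obtain ⟨T, hT, hclus⟩ := ((isCompact_closedBall (0 : E →L[ℝ] F) C).inter_right
    hU.isClosed_compl).exists_mapClusterPt_of_frequently hfreq
  exact hT.2 (hsub hclus)

/-- Separation of the generalized derivative from the kernel of a linear map. -/
theorem LocallyLipschitz.exists_functional_of_forall_ne_zero {W : Type*} [NormedAddCommGroup W]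
    [NormedSpace ℝ W] {G : E → F} (hG : LocallyLipschitz G) {x : E} (φ : (E →L[ℝ] F) →L[ℝ] W)
    (h : ∀ T ∈ convexHull ℝ (clusterDerivatives G x), φ T ≠ 0) :
    ∃ f : W →L[ℝ] ℝ, ∃ δ > 0,
      ∀ᶠ z in 𝓝 x, DifferentiableAt ℝ G z → δ ≤ f (φ (fderiv ℝ G z)) := by
  have hcomp := ((hG.isCompact_clusterDerivatives x).convexHull_of_finiteDimensional).image
    φ.continuous
  obtain ⟨f, δ, h0, hδ⟩ := geometric_hahn_banach_point_closed (x := (0 : W))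
    ((convex_convexHull ℝ _).linear_image φ.toLinearMap) hcomp.isClosed
    (by rintro ⟨T, hT, h0⟩; exact h T hT h0)
  rw [map_zero] at h0
  refine ⟨f, δ, h0, ?_⟩
  have hopen : IsOpen {T : E →L[ℝ] F | δ < f (φ T)} :=
    isOpen_lt continuous_const (f.continuous.comp φ.continuous)
  filter_upwards [hG.eventually_fderiv_mem hopen fun T hT =>
    hδ _ ⟨T, subset_convexHull ℝ _ hT, rfl⟩] with z hz hd
  exact (hz hd).le

theorem LocallyLipschitz.eventually_mul_le_of_eventually_le_fderiv {G : E → F}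
    (hG : LocallyLipschitz G) (f : F →L[ℝ] ℝ) {x v : E} {δ : ℝ} (hδ : 0 < δ)
    (h : ∀ᶠ z in 𝓝 x, DifferentiableAt ℝ G z → δ ≤ f (fderiv ℝ G z v)) :
    ∀ᶠ p : (E × ℝ) × E in 𝓝 ((x, 0), v), 0 ≤ p.1.2 →
      δ / 2 * p.1.2 ≤ f (G (p.1.1 + p.1.2 • p.2) - G p.1.1) := by
  obtain ⟨C, t, ht, hL⟩ := hG x
  obtain ⟨r, hr, hball⟩ := Metric.mem_nhds_iff.1 (inter_mem ht h)
  have hLb : LipschitzOnWith C G (Metric.ball x r) := hL.mono fun z hz => (hball hz).1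
  have e1 : ∀ᶠ p : (E × ℝ) × E in 𝓝 ((x, 0), v), p.1.1 ∈ Metric.ball x r :=
    (show ContinuousAt (fun p : (E × ℝ) × E => p.1.1) ((x, 0), v) by fun_prop).eventually
      (Metric.ball_mem_nhds x hr)
  have e2 : ∀ᶠ p : (E × ℝ) × E in 𝓝 ((x, 0), v), p.1.1 + p.1.2 • p.2 ∈ Metric.ball x r :=
    (show ContinuousAt (fun p : (E × ℝ) × E => p.1.1 + p.1.2 • p.2) ((x, 0), v) by
      fun_prop).eventually_mem (by simpa using Metric.ball_mem_nhds x hr)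
  have e3 : ∀ᶠ p : (E × ℝ) × E in 𝓝 ((x, 0), v), ‖f‖ * (C * ‖p.2 - v‖) < δ / 2 :=
    (show ContinuousAt (fun p : (E × ℝ) × E => ‖f‖ * (C * ‖p.2 - v‖)) ((x, 0), v) by
      fun_prop).eventually_lt continuousAt_const (by simpa using hδ)
  filter_upwards [e1, e2, e3] with p h1 h2 h3 hp
  refine hLb.mul_le_of_forall_le_fderiv Metric.isOpen_ball (convex_ball x r) f p.2
    (fun z hz hd => ?_) hp h1 h2
  have hb : ‖f (fderiv ℝ G z (p.2 - v))‖ ≤ ‖f‖ * (C * ‖p.2 - v‖) := by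
    refine (f.le_opNorm _).trans ?_
    gcongr
    refine (ContinuousLinearMap.le_opNorm _ _).trans ?_
    gcongr
    exact norm_fderiv_le_of_lipschitzOn ℝ (Metric.isOpen_ball.mem_nhds hz) hLb
  have h4 := (hball hz).2 hd
  rw [map_sub, map_sub] at hb
  have h5 := (abs_le.1 hb).1
  linarith

/-- If all generalized derivatives at `x` are injective, the map is injective near `x`. -/
theorem LocallyLipschitz.exists_nhds_injOn {G : E → F} (hG : LocallyLipschitz G) {x : E}
    (h : ∀ T ∈ convexHull ℝ (clusterDerivatives G x), Function.Injective T) :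
    ∃ U ∈ 𝓝 x, Set.InjOn G U := by
  have hdir : ∀ v ∈ Metric.sphere (0 : E) 1, ∀ᶠ p : (E × ℝ) × E in 𝓝 ((x, 0), v),
      0 < p.1.2 → G (p.1.1 + p.1.2 • p.2) ≠ G p.1.1 := by
    intro v hv
    obtain ⟨f, δ, hδ, hf⟩ := hG.exists_functional_of_forall_ne_zero (x := x)
      (ContinuousLinearMap.apply ℝ F v) fun T hT h0 => by
        have hv0 : v = 0 := h T hT (by simpa using h0)
        simp [hv0] at hv
    filter_upwards [hG.eventually_mul_le_of_eventually_le_fderiv f hδ hf] with p hp hpos heq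
    have := hp hpos.le
    rw [heq, sub_self, map_zero] at this
    nlinarith [mul_pos hδ hpos]
  have hall : ∀ᶠ q : E × ℝ in 𝓝 (x, 0), ∀ v ∈ Metric.sphere (0 : E) 1,
      0 < q.2 → G (q.1 + q.2 • v) ≠ G q.1 :=
    (isCompact_sphere (0 : E) 1).eventually_forall_of_forall_eventually hdir
  have hpair : ∀ᶠ q : E × E in 𝓝 (x, x), q.1 ≠ q.2 → G q.2 ≠ G q.1 := by
    have hc : Tendsto (fun q : E × E => (q.1, ‖q.2 - q.1‖)) (𝓝 (x, x)) (𝓝 (x, 0)) := by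
      have : ContinuousAt (fun q : E × E => (q.1, ‖q.2 - q.1‖)) (x, x) := by fun_prop
      simpa [ContinuousAt] using this
    filter_upwards [hc.eventually hall] with q hq hne
    have hpos : 0 < ‖q.2 - q.1‖ := norm_pos_iff.2 (sub_ne_zero.2 hne.symm)
    have := hq (‖q.2 - q.1‖⁻¹ • (q.2 - q.1))
      (by simp [norm_smul, inv_mul_cancel₀ hpos.ne']) hpos
    simpa [smul_smul, mul_inv_cancel₀ hpos.ne'] using this
  rw [nhds_prod_eq] at hpair
  obtain ⟨U, hU, hUU⟩ := mem_prod_self_iff.1 hpair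
  exact ⟨U, hU, fun y hy z hz heq =>
    by_contra fun hne => hUU (Set.mk_mem_prod hy hz) hne heq.symm⟩

end ClusterDerivatives

section InverseFunction

variable {E : Type*} [NormedAddCommGroup E] [InnerProductSpace ℝ E] [FiniteDimensional ℝ E]
  {G : E → E}

/-- Fermat's rule for the distance of a locally Lipschitz map to a point. -/
theorem LocallyLipschitz.eq_of_isLocalMin_norm_sub (hG : LocallyLipschitz G) {x y : E}
    (h : ∀ T ∈ convexHull ℝ (clusterDerivatives G x), Function.Injective T)
    (hmin : IsLocalMin (fun z => ‖G z - y‖) x) : G x = y := by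
  by_contra hne
  set w := G x - y with hw
  have hw0 : w ≠ 0 := sub_ne_zero.2 hne
  let φ : (E →L[ℝ] E) →ₗ[ℝ] E :=
    { toFun := fun T => ContinuousLinearMap.adjoint T w
      map_add' := fun S T => by simp
      map_smul' := fun c T => by simp }
  obtain ⟨f, δ, hδ, hf⟩ := hG.exists_functional_of_forall_ne_zero (x := x)
    φ.toContinuousLinearMap fun T hT h0 => by
      obtain ⟨v, hv⟩ := (LinearMap.injective_iff_surjective (f := T.toLinearMap)).1 (h T hT) w
      have h1 : inner ℝ v (ContinuousLinearMap.adjoint T w) = inner ℝ w w := by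
        rw [ContinuousLinearMap.adjoint_inner_right]
        exact congrArg (fun u => inner ℝ u w) hv
      rw [show ContinuousLinearMap.adjoint T w = 0 from h0, inner_zero_right] at h1
      exact hw0 (inner_self_eq_zero.1 h1.symm)
  obtain ⟨v, rfl⟩ := (InnerProductSpace.toDual ℝ E).surjective f
  have hf' : ∀ᶠ z in 𝓝 x, DifferentiableAt ℝ G z →
      δ ≤ (innerSL ℝ w) (fderiv ℝ G z v) := by
    filter_upwards [hf] with z hz hd
    have h1 : δ ≤ inner ℝ v (ContinuousLinearMap.adjoint (fderiv ℝ G z) w) := hz hd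
    rwa [ContinuousLinearMap.adjoint_inner_right, real_inner_comm] at h1
  have hinc := hG.eventually_mul_le_of_eventually_le_fderiv (innerSL ℝ w) hδ hf'
  obtain ⟨C, t, ht, hL⟩ := hG x
  have hstep : Tendsto (fun s : ℝ => x - s • v) (𝓝[>] 0) (𝓝 x) := by
    have : ContinuousAt (fun s : ℝ => x - s • v) 0 := by fun_prop
    simpa [ContinuousAt] using this.tendsto.mono_left nhdsWithin_le_nhds
  have hline : Tendsto (fun s : ℝ => ((x - s • v, s), v)) (𝓝[>] 0) (𝓝 ((x, 0), v)) :=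
    (hstep.prodMk_nhds (tendsto_nhdsWithin_of_tendsto_nhds tendsto_id)).prodMk_nhds
      tendsto_const_nhds
  have hsmall : ∀ᶠ s : ℝ in 𝓝[>] 0, (C * ‖v‖) ^ 2 * s < δ := by
    refine nhdsWithin_le_nhds ?_
    exact (show ContinuousAt (fun s : ℝ => (C * ‖v‖) ^ 2 * s) 0 by fun_prop).eventually_lt
      continuousAt_const (by simpa using hδ)
  obtain ⟨s, h1, h2, h3, h4, hs⟩ := ((hline.eventually hinc).and <| (hstep.eventually hmin).and <|
    hsmall.and <| (hstep.eventually ht).and self_mem_nhdsWithin).exists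
  have hs : 0 < s := hs
  have h1 := h1 hs.le
  simp only [sub_add_cancel, innerSL_apply_apply] at h1
  have h5 : ‖G x - G (x - s • v)‖ ≤ C * ‖v‖ * s := by
    refine (hL.norm_sub_le (mem_of_mem_nhds ht) h4).trans_eq ?_
    rw [sub_sub_cancel, norm_smul, Real.norm_of_nonneg hs.le]
    ring
  have h6 : G (x - s • v) - y = w - (G x - G (x - s • v)) := by rw [hw]; abel
  have h7 : ‖w‖ ^ 2 ≤ ‖w - (G x - G (x - s • v))‖ ^ 2 := by
    rw [← h6]
    gcongr
  rw [norm_sub_sq_real w (G x - _)] at h7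
  have h8 : ‖G x - G (x - s • v)‖ ^ 2 ≤ (C * ‖v‖ * s) ^ 2 := by gcongr
  nlinarith [mul_lt_mul_of_pos_right h3 hs]

theorem LocallyLipschitz.isOpenMap_of_injective_clusterDerivatives (hG : LocallyLipschitz G)
    (h : ∀ x, ∀ T ∈ convexHull ℝ (clusterDerivatives G x), Function.Injective T) :
    IsOpenMap G := by
  rw [isOpenMap_iff_nhds_le]
  intro x V hV
  obtain ⟨U, hU, hinj⟩ := hG.exists_nhds_injOn (h x)
  obtain ⟨r, hr, hball⟩ := Metric.nhds_basis_closedBall.mem_iff.1 (inter_mem hU hV)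
  have hxr : x ∈ Metric.closedBall x r := Metric.mem_closedBall_self hr.le
  have hsph : G x ∉ G '' Metric.sphere x r := by
    rintro ⟨z, hz, hzx⟩
    have : z = x :=
      hinj (hball (Metric.sphere_subset_closedBall hz)).1 (hball hxr).1 hzx
    simp [this, hr.ne] at hz
  obtain ⟨m, hm, hmsub⟩ := Metric.mem_nhds_iff.1
    (((isCompact_sphere x r).image hG.continuous).isClosed.isOpen_compl.mem_nhds hsph)
  refine mem_of_superset (Metric.ball_mem_nhds (G x) (half_pos hm)) fun y hy => ?_
  obtain ⟨z, hz, hzmin⟩ := (isCompact_closedBall x r).exists_isMinOn ⟨x, hxr⟩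
    (f := fun z => ‖G z - y‖) ((hG.continuous.sub continuous_const).norm.continuousOn)
  rw [Metric.mem_ball, dist_comm, dist_eq_norm] at hy
  have hzlt : z ∈ Metric.ball x r := by
    by_contra hnot
    have hzs : z ∈ Metric.sphere x r :=
      le_antisymm hz (not_lt.1 hnot)
    refine hmsub (a := G z) ?_ ⟨z, hzs, rfl⟩
    have h1 : ‖G z - y‖ ≤ ‖G x - y‖ := hzmin hxr
    calc dist (G z) (G x) ≤ dist (G z) y + dist y (G x) := dist_triangle _ _ _
      _ = ‖G z - y‖ + ‖G x - y‖ := by rw [dist_eq_norm, dist_comm, dist_eq_norm]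
      _ < m := by linarith
  have hloc : IsLocalMin (fun z => ‖G z - y‖) z :=
    hzmin.isLocalMin (mem_of_superset (Metric.isOpen_ball.mem_nhds hzlt)
      Metric.ball_subset_closedBall)
  have := hG.eq_of_isLocalMin_norm_sub (h z) hloc
  rw [← this]
  exact (hball hz).2

/-- A proper locally Lipschitz map of a Euclidean space into itself all of whose generalized
derivatives are invertible is a bijection. -/
theorem LocallyLipschitz.bijective_of_injective_clusterDerivatives (hG : LocallyLipschitz G)
    (h : ∀ x, ∀ T ∈ convexHull ℝ (clusterDerivatives G x), Function.Injective T)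
    (hcoer : Tendsto (fun x => ‖G x‖) (cocompact E) atTop) : Function.Bijective G := by
  have hprop : IsProperMap G := isProperMap_iff_tendsto_cocompact.2
    ⟨hG.continuous, tendsto_norm_atTop_iff_cobounded.1 hcoer |>.mono_right
      (Metric.cobounded_eq_cocompact (α := E)).le⟩
  exact (IsOpenMap.isLocalHomeomorph_of_locally_injOn hG.continuous
    (hG.isOpenMap_of_injective_clusterDerivatives h)
    fun x => hG.exists_nhds_injOn (h x)).bijective_of_isProperMap hprop

end InverseFunction

theorem Matrix.norm_toEuclideanLin_le_sqrt_mul {N : ℕ} (A : Matrix (Fin N) (Fin N) ℝ) {l : ℝ}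
    (hl : l ∈ upperBounds
      {μ : ℝ | Module.End.HasEigenvalue (Matrix.toLin' (A.transpose * A)) μ})
    (x : EuclideanSpace ℝ (Fin N)) : ‖Matrix.toEuclideanLin A x‖ ≤ Real.sqrt l * ‖x‖ := by
  have hherm : (l • (1 : Matrix (Fin N) (Fin N) ℝ) - A.transpose * A).IsHermitian := by
    simp [Matrix.IsHermitian]
  have hpsd : (l • (1 : Matrix (Fin N) (Fin N) ℝ) - A.transpose * A).PosSemidef := by
    rw [hherm.posSemidef_iff_eigenvalues_nonneg]
    intro i
    have hv := hherm.mulVec_eigenvectorBasis i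
    have hv0 : (hherm.eigenvectorBasis i).ofLp ≠ 0 := fun h0 =>
      hherm.eigenvectorBasis.orthonormal.ne_zero i (WithLp.ofLp_injective 2 h0)
    have h1 := hl (Module.End.hasEigenvalue_of_hasEigenvector
      (f := Matrix.toLin' (A.transpose * A)) (μ := l - hherm.eigenvalues i)
      (x := (hherm.eigenvectorBasis i).ofLp) ⟨?_, hv0⟩)
    · simpa using h1
    · rw [Module.End.mem_eigenspace_iff, Matrix.toLin'_apply, sub_smul, ← hv,
        Matrix.sub_mulVec, Matrix.smul_mulVec, Matrix.one_mulVec, sub_sub_cancel]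
  have hquad : ‖Matrix.toEuclideanLin A x‖ ^ 2 ≤ l * ‖x‖ ^ 2 := by
    have h2 := hpsd.dotProduct_mulVec_nonneg x.ofLp
    rw [Matrix.sub_mulVec, Matrix.smul_mulVec, Matrix.one_mulVec, dotProduct_sub,
      dotProduct_smul, ← Matrix.mulVec_mulVec, Matrix.dotProduct_mulVec,
      star_trivial, Matrix.vecMul_transpose] at h2
    rw [EuclideanSpace.real_norm_sq_eq, EuclideanSpace.real_norm_sq_eq]
    simpa [dotProduct, pow_two] using h2
  rcases (norm_nonneg x).eq_or_lt with h0 | hpos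
  · simp [norm_eq_zero.1 h0.symm]
  · have hl0 : 0 ≤ l := by
      by_contra hneg
      nlinarith [sq_nonneg ‖Matrix.toEuclideanLin A x‖, pow_pos hpos 2]
    refine abs_le_of_sq_le_sq' ?_ (by positivity) |>.2
    rwa [mul_pow, Real.sq_sqrt hl0]

theorem toEuclideanLin_jacobianMatrix {n k : ℕ}
    (f : EuclideanSpace ℝ (Fin n) → EuclideanSpace ℝ (Fin k)) (x : EuclideanSpace ℝ (Fin n)) :
    Matrix.toEuclideanLin (jacobianMatrix f x) = (fderiv ℝ f x).toLinearMap := by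
  refine (EuclideanSpace.basisFun (Fin n) ℝ).toBasis.ext fun j => ?_
  ext i
  simp [jacobianMatrix, Matrix.toLpLin_apply]

theorem mem_limitingJacobians_of_mem_clusterDerivatives {n k : ℕ}
    {f : EuclideanSpace ℝ (Fin n) → EuclideanSpace ℝ (Fin k)} {x : EuclideanSpace ℝ (Fin n)}
    {T : EuclideanSpace ℝ (Fin n) →L[ℝ] EuclideanSpace ℝ (Fin k)}
    (hT : T ∈ clusterDerivatives f x) :
    Matrix.toEuclideanLin.symm T.toLinearMap ∈ limitingJacobians f x := by
  obtain ⟨u, huT, hu⟩ := MapClusterPt.exists_seq_tendsto hT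
  obtain ⟨hux, hud⟩ := tendsto_nhdsWithin_iff.1 hu
  obtain ⟨m, hm⟩ := eventually_atTop.1 hud
  refine ⟨fun i => u (i + m), fun i => hm _ (Nat.le_add_left m i),
    hux.comp (tendsto_add_atTop_nat m), ?_⟩
  let ψ : (EuclideanSpace ℝ (Fin n) →L[ℝ] EuclideanSpace ℝ (Fin k)) →ₗ[ℝ]
      Matrix (Fin k) (Fin n) ℝ :=
    Matrix.toEuclideanLin.symm.toLinearMap ∘ₗ ContinuousLinearMap.coeLM ℝ
  have hψ : ∀ z, ψ (fderiv ℝ f z) = jacobianMatrix f z := fun z =>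
    (LinearEquiv.symm_apply_eq _).2 (toEuclideanLin_jacobianMatrix f z).symm
  have hlim := ((ψ.continuous_of_finiteDimensional.tendsto T).comp huT).comp
    (tendsto_add_atTop_nat m)
  exact hlim.congr fun i => hψ _

theorem injective_sub_of_mem_convexHull_clusterDerivatives {N : ℕ}
    (A : Matrix (Fin N) (Fin N) ℝ)
    {F : EuclideanSpace ℝ (Fin N) → EuclideanSpace ℝ (Fin N)} {x : EuclideanSpace ℝ (Fin N)}
    (hdet : ∀ B ∈ generalizedJacobian F x, (A - B).det ≠ 0)
    {T : EuclideanSpace ℝ (Fin N) →L[ℝ] EuclideanSpace ℝ (Fin N)}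
    (hT : T ∈ convexHull ℝ (clusterDerivatives F x)) :
    Function.Injective ((Matrix.toEuclideanLin A).toContinuousLinearMap - T) := by
  let ψ : (EuclideanSpace ℝ (Fin N) →L[ℝ] EuclideanSpace ℝ (Fin N)) →ₗ[ℝ]
      Matrix (Fin N) (Fin N) ℝ :=
    Matrix.toEuclideanLin.symm.toLinearMap ∘ₗ ContinuousLinearMap.coeLM ℝ
  have hmem : ψ T ∈ generalizedJacobian F x := by
    have h1 : ψ T ∈ ψ '' convexHull ℝ (clusterDerivatives F x) := ⟨T, hT, rfl⟩
    rw [ψ.image_convexHull] at h1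
    refine convexHull_mono ?_ h1
    rintro _ ⟨S, hS, rfl⟩
    exact mem_limitingJacobians_of_mem_clusterDerivatives hS
  have hd := hdet _ hmem
  have hinj : Function.Injective (Matrix.toEuclideanLin (A - ψ T)) := by
    rw [injective_iff_map_eq_zero]
    intro v hv
    have h0 : (A - ψ T).mulVec v.ofLp = 0 := congrArg WithLp.ofLp hv
    exact WithLp.ofLp_injective 2 (Matrix.eq_zero_of_mulVec_eq_zero hd h0)
  convert hinj using 1
  ext v : 1
  simp [ψ]

theorem sub_mem_clusterDerivatives {E F : Type*} [NormedAddCommGroup E] [NormedSpace ℝ E]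
    [NormedAddCommGroup F] [NormedSpace ℝ F] (L : E →L[ℝ] F) {G : E → F} {x : E} {T : E →L[ℝ] F}
    (hT : T ∈ clusterDerivatives (fun z => L z - G z) x) : L - T ∈ clusterDerivatives G x := by
  have hset : {z | DifferentiableAt ℝ (fun z => L z - G z) z} = {z | DifferentiableAt ℝ G z} := by
    ext z
    refine ⟨fun h => ?_, fun h => L.differentiableAt.sub h⟩
    simpa using (L.differentiableAt (x := z)).fun_sub h
  have h1 : MapClusterPt T (𝓝[{z | DifferentiableAt ℝ G z}] x)
      (fderiv ℝ fun z => L z - G z) := hset ▸ hT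
  refine (h1.continuousAt_comp (f := fun S => L - S) (by fun_prop)).congrFun ?_
  filter_upwards [self_mem_nhdsWithin] with z hz
  simp [fderiv_fun_sub L.differentiableAt hz]

theorem sub_mem_convexHull_clusterDerivatives {E F : Type*} [NormedAddCommGroup E]
    [NormedSpace ℝ E] [NormedAddCommGroup F] [NormedSpace ℝ F] (L : E →L[ℝ] F) {G : E → F} {x : E}
    {T : E →L[ℝ] F} (hT : T ∈ convexHull ℝ (clusterDerivatives (fun z => L z - G z) x)) :
    L - T ∈ convexHull ℝ (clusterDerivatives G x) := by
  refine convexHull_min (t := {T | L - T ∈ convexHull ℝ (clusterDerivatives G x)})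
    (fun S hS => subset_convexHull ℝ _ (sub_mem_clusterDerivatives L hS)) ?_ hT
  intro S hS S' hS' a b ha hb hab
  have h1 := convex_convexHull ℝ (clusterDerivatives G x) hS hS' ha hb hab
  have h2 : a • (L - S) + b • (L - S') = L - (a • S + b • S') := by
    rw [smul_sub, smul_sub, sub_add_sub_comm, ← add_smul, hab, one_smul]
  exact Set.mem_ofPred.2 (h2 ▸ h1)

theorem theorem8 {N : ℕ} (A : Matrix (Fin N) (Fin N) ℝ)
    (hA : (Matrix.transpose A * A).PosDef)
    (lamN : ℝ)
    (hlamN : IsGreatest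
      {μ : ℝ | Module.End.HasEigenvalue (Matrix.toLin' (Matrix.transpose A * A)) μ} lamN)
    (F : EuclideanSpace ℝ (Fin N) → EuclideanSpace ℝ (Fin N))
    (hF : LocallyLipschitz F)
    (hgrowth : ∃ b : ℝ, Real.sqrt lamN < b ∧
      ∃ R : ℝ, ∀ x : EuclideanSpace ℝ (Fin N), R ≤ ‖x‖ → b * ‖x‖ ≤ ‖F x‖)
    (hdet : ∀ x : EuclideanSpace ℝ (Fin N), ∀ B ∈ generalizedJacobian F x, (A - B).det ≠ 0) :
    ∀ ξ : EuclideanSpace ℝ (Fin N), ∃! x : EuclideanSpace ℝ (Fin N),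
      Matrix.toEuclideanLin A x = F x + ξ := by
  obtain ⟨b, hb, R, hR⟩ := hgrowth
  set L := (Matrix.toEuclideanLin A).toContinuousLinearMap with hL
  have hlip : LocallyLipschitz fun x => L x - F x :=
    (LipschitzWith.prod_fst.sub LipschitzWith.prod_snd).locallyLipschitz.comp
      (L.lipschitz.locallyLipschitz.prodMk hF)
  have hinj : ∀ x, ∀ T ∈ convexHull ℝ (clusterDerivatives (fun z => L z - F z) x),
      Function.Injective T := fun x T hT => by
    have := injective_sub_of_mem_convexHull_clusterDerivatives A (hdet x)
      (sub_mem_convexHull_clusterDerivatives L hT)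
    rwa [← hL, sub_sub_cancel] at this
  have hcoer : Tendsto (fun x => ‖L x - F x‖) (cocompact _) atTop := by
    have hnorm := tendsto_norm_cocompact_atTop (E := EuclideanSpace ℝ (Fin N))
    refine tendsto_atTop_mono' _ ?_ (hnorm.const_mul_atTop (sub_pos.2 hb))
    filter_upwards [hnorm.eventually_ge_atTop R] with x hx
    have h1 : ‖L x‖ ≤ Real.sqrt lamN * ‖x‖ := A.norm_toEuclideanLin_le_sqrt_mul hlamN.2 x
    have h2 := norm_sub_norm_le (F x) (L x)
    rw [norm_sub_rev] at h2
    linarith [hR x hx]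
  intro ξ
  obtain ⟨x, hx, huniq⟩ :=
    (hlip.bijective_of_injective_clusterDerivatives hinj hcoer).existsUnique ξ
  exact ⟨x, sub_eq_iff_eq_add'.1 hx, fun y hy => huniq y (sub_eq_iff_eq_add'.2 hy)⟩
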